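/- **Theorem.** Let $\mathfrak{H}$ be a class of (infinite) regular cardinals whose infimum (i.e. least element) $\inf\mathfrak{H}$ is a weakly compact cardinal, where a cardinal $\kappa$ is weakly compact if $\kappa>\aleph_0$ and $\kappa\to(\kappa)^2_2$, that is, for every colouring of the two-element subsets of a set of size $\kappa$ with two colours there is a subset of size $\kappa$ all of whose two-element subsets have the same colour. Then $\mathbf{P}(\mathfrak{H})$ holds: for every linearly ordered topological space $X$ (a linearly ordered set with the topology generated by its open rays), the following are equivalent: 1. $X$ is $\mathfrak{H}$-compact, i.e. for every $\kappa\in\mathfrak{H}$ the space $X$ is $[\kappa,\kappa]$-compact: every open covering of $X$ of cardinality $\le\kappa$ has a subcovering of cardinality $<\kappa$; 2. $X$ has no gap of type in $\mathfrak{H}$. Here a gap of $X$ is an ordered pair $(A,B)$ of open (possibly empty) subsets of $X$ with $A\cup B=X$, with $a<b$ for all $a\in A$ and $b\in B$, such that $A$ has no maximum and $B$ has no minimum; a cardinal $\kappa$ is a type of the gap $(A,B)$ if the cofinality of $A$ is $\kappa$ or the coinitiality of $B$ is $\kappa$. -/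

import Mathlib

open scoped Cardinal

universe u

/-- A cardinal `κ` is weakly compact if it is uncountable and `κ → (κ)²₂`: every colouring of the
unordered pairs of a set of size `κ` with two colours has a homogeneous subset of size `κ`.
(Values of the colouring on the diagonal play no role.) -/
def IsWeaklyCompactCardinal (κ : Cardinal.{u}) : Prop :=
  ℵ₀ < κ ∧ ∀ S : Type u, #S = κ → ∀ c : Sym2 S → Bool,
    ∃ (T : Set S) (i : Bool), #T = κ ∧ T.Pairwise fun x y => c s(x, y) = i

/-- `[κ, μ]`-compactness: every open covering of cardinality `≤ μ` has a subcovering of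
cardinality `< κ`. -/
def IsIntervalCompact (κ μ : Cardinal.{u}) (X : Type u) [TopologicalSpace X] : Prop :=
  ∀ 𝒰 : Set (Set X), (∀ U ∈ 𝒰, IsOpen U) → ⋃₀ 𝒰 = Set.univ → #𝒰 ≤ μ →
    ∃ 𝒱 ⊆ 𝒰, ⋃₀ 𝒱 = Set.univ ∧ #𝒱 < κ

/-- A space is `𝔥`-compact if it is `[κ, κ]`-compact for every `κ ∈ 𝔥`. -/
def IsClassCompact (𝔥 : Set Cardinal.{u}) (X : Type u) [TopologicalSpace X] : Prop :=
  ∀ κ ∈ 𝔥, IsIntervalCompact κ κ X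

/-- `(A, B)` is a gap of `X`. Either side is allowed to be empty. -/
structure IsGap {X : Type u} [LinearOrder X] [TopologicalSpace X] (A B : Set X) : Prop where
  isOpen_left : IsOpen A
  isOpen_right : IsOpen B
  union_eq : A ∪ B = Set.univ
  lt : ∀ a ∈ A, ∀ b ∈ B, a < b
  no_max : ¬ ∃ a, IsGreatest A a
  no_min : ¬ ∃ b, IsLeast B b

/-- `κ` is a type of the pair `(A, B)`: the cofinality of `A` or the coinitiality of `B` is `κ`. -/
def IsTypeOfGap {X : Type u} [LinearOrder X] (A B : Set X) (κ : Cardinal.{u}) : Prop :=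
  Order.cof A = κ ∨ Order.cof (↥B)ᵒᵈ = κ

/-- `X` has no gap having a type in `𝔥`. -/
def HasNoGapOfTypeIn (𝔥 : Set Cardinal.{u}) (X : Type u) [LinearOrder X] [TopologicalSpace X] :
    Prop :=
  ∀ A B : Set X, IsGap A B → ∀ κ ∈ 𝔥, ¬ IsTypeOfGap A B κ

/-- The property `P(𝔥)`: every linearly ordered topological space is `𝔥`-compact if and only if
it has no gap of type in `𝔥`. -/
def PropertyP (𝔥 : Set Cardinal.{u}) : Prop :=
  ∀ (X : Type u) [LinearOrder X] [TopologicalSpace X] [OrderTopology X],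
    IsClassCompact 𝔥 X ↔ HasNoGapOfTypeIn 𝔥 X

/-! A gap `(A, B)` with `cof A = κ` gives a bad covering: `B` and the rays below a cofinal subset of
`A`; the other side is dual. Conversely, fix `κ ∈ 𝔥` and an open covering of size `≤ κ`, and
identify points whose interval is covered by fewer than `κ` members. Each class is covered by fewer
than `κ` members (`isCoveredByLT_setOf_Icc`): its upper half ends at a maximum or at a gap of left
cofinality other than `κ`. There are fewer than `κ` classes: otherwise take `μ = inf 𝔥 ≤ κ`
inequivalent points; weak compactness extracts a monotone `μ`-sequence, and without gaps of type `μ`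
one member contains an interval between two of its terms. Regularity of `κ` combines the two bounds.
-/

open Set Order Topology
open Cardinal hiding univ

/-! ### Cofinality and monotone sequences. -/

section Order

/-- A function on a linear order `A` can be iterated along any well-order smaller than the
cofinality of `A`. -/
theorem exists_seq_lt_of_mk_lt_cof {I A : Type u} [LinearOrder I] [WellFoundedLT I] [LinearOrder A]
    (g : A → A) (h : #I < Order.cof A) : ∃ f : I → A, ∀ i j, j < i → g (f j) < f i := by
  have hb : ∀ (i : I) (F : ∀ j, j < i → A), ∃ x, ∀ j (hj : j < i), g (F j hj) < x := by
    intro i F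
    have hs : ¬ IsCofinal (range fun j : Iio i => g (F j.1 j.2)) := fun hs =>
      (((cof_le hs).trans mk_range_le).trans (mk_set_le _)).not_gt h
    obtain ⟨x, hx⟩ := not_isCofinal_iff.1 hs
    exact ⟨x, fun j hj => hx _ ⟨⟨j, hj⟩, rfl⟩⟩
  choose b hb using hb
  refine ⟨(wellFounded_lt (α := I)).fix b, fun i j hji => ?_⟩
  rw [(wellFounded_lt (α := I)).fix_eq b i]
  exact hb i (fun j _ => (wellFounded_lt (α := I)).fix b j) j hji

/-- A smaller cofinal subset would make `T` a union of fewer than `κ` initial segments, each of size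
below `κ`. -/
theorem cof_eq_of_mk_eq_of_isRegular {κ : Cardinal.{u}} (hκ : κ.IsRegular) {T : Set κ.ord.ToType}
    (hT : #T = κ) : Order.cof T = κ := by
  refine le_antisymm ((cof_le_cardinalMk T).trans_eq hT) (le_cof_iff.2 fun s hs => ?_)
  by_contra! hlt
  have hsub : (univ : Set T) ⊆ ⋃ x : s, Iic x.1 := fun t _ => by
    obtain ⟨x, hx, htx⟩ := hs t
    exact mem_iUnion.2 ⟨⟨x, hx⟩, htx⟩
  have := noMaxOrder hκ.aleph0_le
  have hIic : ∀ x : s, #(Iic x.1) < κ := fun x => by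
    obtain ⟨y, hy⟩ := exists_gt (x.1 : κ.ord.ToType)
    have h1 : #(Iio y) < κ := by simpa using mk_Iio_lt y (by simp)
    refine lt_of_le_of_lt (mk_le_of_injective
      (f := fun t : Iic x.1 => (⟨t.1.1, lt_of_le_of_lt t.2 hy⟩ : Iio y)) ?_) h1
    intro a b hab
    exact Subtype.ext (Subtype.ext (congrArg (fun z : Iio y => z.1) hab))
  have := (mk_le_mk_of_subset hsub).trans_lt
    ((card_iUnion_lt_iff_forall_of_isRegular hκ hlt).2 hIic)
  rw [mk_univ, hT] at this
  exact this.false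

/-- A regular weakly compact number of points of a linear order contains a strictly monotone or a
strictly antitone sequence of the same length. -/
theorem IsWeaklyCompactCardinal.exists_strictMono_or_strictAnti {κ : Cardinal.{u}}
    (h : IsWeaklyCompactCardinal κ) {X : Type*} [LinearOrder X] {e : κ.ord.ToType → X}
    (he : Function.Injective e) :
    ∃ T : Set κ.ord.ToType, #T = κ ∧
      (StrictMono (fun t : T => e t) ∨ StrictAnti (fun t : T => e t)) := by
  classical
  -- The colour of a pair records whether `e` preserves its order.
  obtain ⟨T, b, hT, hb⟩ := h.2 κ.ord.ToType (by simp)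
    (Sym2.lift ⟨fun i j => decide (e (min i j) < e (max i j)), fun i j => by
      simp only [min_comm, max_comm]⟩)
  refine ⟨T, hT, ?_⟩
  have key : ∀ i j : T, i < j → decide (e i < e j) = b := fun i j hij => by
    have hij' : (i : κ.ord.ToType) < j := hij
    simpa [min_eq_left hij'.le, max_eq_right hij'.le] using hb i.2 j.2 hij'.ne
  cases b with
  | true => exact .inl fun i j hij => by simpa using key i j hij
  | false =>
    refine .inr fun i j hij => lt_of_le_of_ne (by simpa using key i j hij) fun hne => ?_
    exact hij.ne' (Subtype.ext (he hne))

end Order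

/-! ### Gaps and tails of monotone sequences. -/

section Gap

variable {X : Type u} [LinearOrder X] [TopologicalSpace X]

theorem IsGap.dual {A B : Set X} (h : IsGap A B) :
    IsGap (OrderDual.ofDual ⁻¹' B) (OrderDual.ofDual ⁻¹' A) where
  isOpen_left := h.isOpen_right
  isOpen_right := h.isOpen_left
  union_eq := (union_comm _ _).trans h.union_eq
  lt b hb a ha := h.lt a ha b hb
  no_max := h.no_min
  no_min := h.no_max

theorem HasNoGapOfTypeIn.dual {𝔥 : Set Cardinal.{u}} (h : HasNoGapOfTypeIn 𝔥 X) :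
    HasNoGapOfTypeIn 𝔥 Xᵒᵈ := fun A B hAB κ hκ ht =>
  h (OrderDual.toDual ⁻¹' B) (OrderDual.toDual ⁻¹' A) hAB.dual κ hκ ht.symm

variable [OrderTopology X]

theorem IsLowerSet.isGap_compl {A : Set X} (hl : IsLowerSet A) (ho : IsOpen A) (hc : IsOpen Aᶜ)
    (hne : A.Nonempty) (hmax : ¬ ∃ a, IsGreatest A a) : IsGap A Aᶜ where
  isOpen_left := ho
  isOpen_right := hc
  union_eq := union_compl_self A
  lt a ha b hb := lt_of_not_ge fun hba => hb (hl hba ha)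
  no_max := hmax
  no_min := by
    rintro ⟨b, hb, hmin⟩
    obtain ⟨a, ha⟩ := hne
    have hab : a < b := lt_of_not_ge fun hba => hb (hl hba ha)
    -- Openness of `Aᶜ` at its minimum `b` yields a point `l < b` that would be the maximum of `A`.
    obtain ⟨l, hlb, hsub⟩ := exists_Ioc_subset_of_mem_nhds (hc.mem_nhds hb) ⟨a, hab⟩
    have hlA : l ∈ A := by_contra fun h => hlb.not_ge (hmin h)
    refine hmax ⟨l, hlA, fun c hc' => le_of_not_gt fun hlc => ?_⟩
    exact hsub ⟨hlc, le_of_not_gt fun hbc => hb (hl hbc.le hc')⟩ hc'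

/-- In the absence of gaps of the corresponding type, every open covering has a member containing
a tail of a given strictly increasing sequence, together with the intervals between its members. -/
theorem exists_forall_Icc_subset {I : Type u} [LinearOrder I] [Nonempty I] [NoMaxOrder I]
    {f : I → X} (hf : StrictMono f) (hgap : ∀ A B : Set X, IsGap A B → Order.cof A ≠ Order.cof I)
    {𝒰 : Set (Set X)} (ho : ∀ U ∈ 𝒰, IsOpen U) (hU : ⋃₀ 𝒰 = univ) :
    ∃ i, ∃ U ∈ 𝒰, ∀ j, Icc (f i) (f j) ⊆ U := by
  set D : Set X := {y | ∃ i, y < f i} with hD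
  have hfD : ∀ i, f i ∈ D := fun i => (exists_gt i).imp fun j hj => hf hj
  have hl : IsLowerSet D := fun a b hba ⟨i, hi⟩ => ⟨i, hba.trans_lt hi⟩
  have hDo : IsOpen D := by
    have : D = ⋃ i, Iio (f i) := by ext; simp [hD]
    rw [this]
    exact isOpen_iUnion fun i => isOpen_Iio
  have hmax : ¬ ∃ a, IsGreatest D a := by
    rintro ⟨a, ⟨i, hi⟩, hmax⟩
    exact hi.not_ge (hmax (hfD i))
  have hcof : Order.cof D = Order.cof I := by
    refine (cof_congr_of_strictMono (f := fun i => (⟨f i, hfD i⟩ : D)) (fun i j h => hf h) ?_).symm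
    rintro ⟨x, i, hi⟩
    exact ⟨_, ⟨i, rfl⟩, hi.le⟩
  -- `D` is not clopen, so it has a supremum `z`; a member around `z` catches a tail.
  have hDc : ¬ IsOpen Dᶜ := fun hDc =>
    hgap D Dᶜ (hl.isGap_compl hDo hDc ⟨_, hfD (Classical.arbitrary I)⟩ hmax) hcof
  rw [isOpen_iff_mem_nhds] at hDc
  push Not at hDc
  obtain ⟨z, hz, hzn⟩ := hDc
  have hlt : ∀ i, f i < z := fun i => lt_of_not_ge fun h => hz (hl h (hfD i))
  obtain ⟨U, hU𝒰, hzU⟩ : z ∈ ⋃₀ 𝒰 := hU ▸ mem_univ z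
  obtain ⟨l, hlz, hsub⟩ := exists_Ioc_subset_of_mem_nhds ((ho U hU𝒰).mem_nhds hzU)
    ⟨_, hlt (Classical.arbitrary I)⟩
  obtain ⟨d, hld, i, hdi⟩ : ∃ d, l < d ∧ d ∈ D := by
    by_contra! h
    exact hzn (Filter.mem_of_superset (Ioi_mem_nhds hlz) h)
  exact ⟨i, U, hU𝒰, fun j y hy => hsub ⟨(hld.trans hdi).trans_le hy.1, hy.2.trans (hlt j).le⟩⟩

end Gap

/-! ### Small subcoverings and the equivalence. -/

section Compactness

/-- `S` is covered by fewer than `κ` members of `𝒰`. -/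
def IsCoveredByLT {X : Type u} (𝒰 : Set (Set X)) (κ : Cardinal.{u}) (S : Set X) : Prop :=
  ∃ 𝒱 ⊆ 𝒰, S ⊆ ⋃₀ 𝒱 ∧ #𝒱 < κ

namespace IsCoveredByLT

variable {X : Type u} {𝒰 : Set (Set X)} {κ : Cardinal.{u}} {S S' U : Set X}

theorem mono (h : IsCoveredByLT 𝒰 κ S) (hS : S' ⊆ S) : IsCoveredByLT 𝒰 κ S' :=
  let ⟨𝒱, h𝒱, hsub, hlt⟩ := h
  ⟨𝒱, h𝒱, hS.trans hsub, hlt⟩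

theorem of_subset_mem (hκ : ℵ₀ ≤ κ) (hU : U ∈ 𝒰) (hS : S ⊆ U) : IsCoveredByLT 𝒰 κ S :=
  ⟨{U}, by simpa using hU, by simpa using hS, by
    simpa using one_lt_aleph0.trans_le hκ⟩

theorem union (hκ : ℵ₀ ≤ κ) (h : IsCoveredByLT 𝒰 κ S) (h' : IsCoveredByLT 𝒰 κ S') :
    IsCoveredByLT 𝒰 κ (S ∪ S') := by
  obtain ⟨𝒱, h𝒱, hsub, hlt⟩ := h
  obtain ⟨𝒱', h𝒱', hsub', hlt'⟩ := h'
  refine ⟨𝒱 ∪ 𝒱', union_subset h𝒱 h𝒱', ?_, (mk_union_le _ _).trans_lt (add_lt_of_lt hκ hlt hlt')⟩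
  rw [sUnion_union]
  exact union_subset_union hsub hsub'

theorem iUnion (hκ : κ.IsRegular) {ι : Type u} (hι : #ι < κ) {S : ι → Set X}
    (h : ∀ i, IsCoveredByLT 𝒰 κ (S i)) : IsCoveredByLT 𝒰 κ (⋃ i, S i) := by
  choose 𝒱 h𝒱 hsub hlt using h
  refine ⟨⋃ i, 𝒱 i, iUnion_subset h𝒱, iUnion_subset fun i => (hsub i).trans ?_,
    (card_iUnion_lt_iff_forall_of_isRegular hκ hι).2 hlt⟩
  exact sUnion_subset_sUnion (subset_iUnion _ i)

theorem Icc_trans [LinearOrder X] (hκ : ℵ₀ ≤ κ) {x y z : X} (h : IsCoveredByLT 𝒰 κ (Icc x y))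
    (h' : IsCoveredByLT 𝒰 κ (Icc y z)) : IsCoveredByLT 𝒰 κ (Icc x z) :=
  (h.union hκ h').mono Icc_subset_Icc_union_Icc

end IsCoveredByLT

variable {X : Type u} [LinearOrder X] [TopologicalSpace X] [OrderTopology X]
  {𝒰 : Set (Set X)} {κ : Cardinal.{u}}

/-- If there is no gap of left type `κ`, then a set with cofinality above `κ` has a tail contained
in a member of a given open covering of cardinality `≤ κ`. -/
theorem exists_forall_Ioc_subset {A : Set X} (hκ : κ.IsRegular) (hA : κ < Order.cof A)
    (hgap : ∀ A B : Set X, IsGap A B → Order.cof A ≠ κ) (ho : ∀ U ∈ 𝒰, IsOpen U)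
    (hU : ⋃₀ 𝒰 = univ) (hle : #𝒰 ≤ κ) : ∃ y ∈ A, ∃ U ∈ 𝒰, ∀ z ∈ A, Ioc y z ⊆ U := by
  by_contra! hcon
  -- At most `κ` members each fail somewhere in `A`, and `cof A > κ` bounds all the failures by one
  -- `y'`. Iterating `κ` times contradicts the absence of gaps.
  have hg : ∀ y : A, ∃ y' : A, ∀ U ∈ 𝒰, ¬ Ioc (y : X) y' ⊆ U := fun y => by
    choose z hzA hz using fun U : 𝒰 => hcon y y.2 U U.2
    have hs : ¬ IsCofinal (range fun U : 𝒰 => (⟨z U, hzA U⟩ : A)) := fun hs =>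
      (((cof_le hs).trans mk_range_le).trans hle).not_gt hA
    obtain ⟨y', hy'⟩ := not_isCofinal_iff.1 hs
    refine ⟨y', fun U hU hsub => hz ⟨U, hU⟩ ((Ioc_subset_Ioc_right ?_).trans hsub)⟩
    exact (hy' _ ⟨⟨U, hU⟩, rfl⟩).le
  choose g hg using hg
  have hgt : ∀ y : A, y < g y := fun y => by
    obtain ⟨U, hU𝒰, -⟩ : (y : X) ∈ ⋃₀ 𝒰 := hU ▸ mem_univ _
    refine lt_of_not_ge fun h => hg y U hU𝒰 ?_
    exact fun w hw => absurd (hw.1.trans_le hw.2) (not_lt_of_ge h)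
  obtain ⟨f, hf⟩ := exists_seq_lt_of_mk_lt_cof (I := κ.ord.ToType) g (by simpa using hA)
  have := noMaxOrder hκ.aleph0_le
  have : Nonempty κ.ord.ToType := by
    rw [← mk_ne_zero_iff]
    simpa using hκ.ne_zero
  have hmono : StrictMono fun i => (f i : X) := fun j i hji => (hgt (f j)).trans (hf i j hji)
  obtain ⟨i, U, hU𝒰, hsub⟩ := exists_forall_Icc_subset hmono
    (fun A B hAB => by
      rw [Ordinal.cof_toType, hκ.cof_ord]
      exact hgap A B hAB) ho hU
  obtain ⟨j, hij⟩ := exists_gt i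
  exact hg (f i) U hU𝒰 fun w hw => hsub j ⟨hw.1.le, hw.2.trans (hf j i hij).le⟩

/-- If there is no gap of left type `κ`, then for every open covering of cardinality `≤ κ`, the
points that can be joined to `x` from above by an interval covered by fewer than `κ` members
of the covering are themselves covered by fewer than `κ` members. -/
theorem isCoveredByLT_setOf_Icc (hκ : κ.IsRegular)
    (hgap : ∀ A B : Set X, IsGap A B → Order.cof A ≠ κ) (ho : ∀ U ∈ 𝒰, IsOpen U)
    (hU : ⋃₀ 𝒰 = univ) (hle : #𝒰 ≤ κ) (x : X) :
    IsCoveredByLT 𝒰 κ {y | x ≤ y ∧ IsCoveredByLT 𝒰 κ (Icc x y)} := by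
  set A : Set X := {y | IsCoveredByLT 𝒰 κ (Icc x y)} with hAdef
  have hκ₀ := hκ.aleph0_le
  have hl : IsLowerSet A := fun a b hba ha => ha.mono (Icc_subset_Icc_right hba)
  have hcx : x ∈ A := by
    obtain ⟨U, hU𝒰, hxU⟩ : x ∈ ⋃₀ 𝒰 := hU ▸ mem_univ x
    exact .of_subset_mem hκ₀ hU𝒰 (by simpa using hxU)
  by_cases hmax : ∃ a, IsGreatest A a
  · obtain ⟨m, hm, hmax⟩ := hmax
    exact IsCoveredByLT.mono hm fun y hy => ⟨hy.1, hmax hy.2⟩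
  -- Membership in `A` is constant on an interval neighbourhood lying in one member, so `A` is
  -- clopen.
  have hloc : ∀ z, ∃ V ∈ 𝓝 z, ∀ a ∈ V, ∀ b ∈ V, a ∈ A → b ∈ A := fun z => by
    obtain ⟨U, hU𝒰, hzU⟩ : z ∈ ⋃₀ 𝒰 := hU ▸ mem_univ z
    obtain ⟨a, b, -, hV, hVU⟩ := exists_Icc_mem_subset_of_mem_nhds ((ho U hU𝒰).mem_nhds hzU)
    exact ⟨_, hV, fun c hc d hd hcA => hcA.Icc_trans hκ₀
      (.of_subset_mem hκ₀ hU𝒰 ((Icc_subset_Icc hc.1 hd.2).trans hVU))⟩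
  have hAo : IsOpen A := isOpen_iff_mem_nhds.2 fun z hz => by
    obtain ⟨V, hV, h⟩ := hloc z
    exact Filter.mem_of_superset hV fun b hb => h z (mem_of_mem_nhds hV) b hb hz
  have hAc : IsOpen Aᶜ := isOpen_iff_mem_nhds.2 fun z hz => by
    obtain ⟨V, hV, h⟩ := hloc z
    exact Filter.mem_of_superset hV fun b hb hbA => hz (h b hb z (mem_of_mem_nhds hV) hbA)
  rcases lt_or_gt_of_ne (hgap A Aᶜ (hl.isGap_compl hAo hAc ⟨x, hcx⟩ hmax)) with hlt | hgt
  · obtain ⟨s, hs, hcard⟩ := exists_cof_eq A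
    refine (IsCoveredByLT.iUnion hκ (hcard.trans_lt hlt) fun a : s => a.1.2).mono ?_
    rintro y ⟨hxy, hy⟩
    obtain ⟨a, ha, hya⟩ := hs ⟨y, hy⟩
    exact mem_iUnion.2 ⟨⟨a, ha⟩, hxy, hya⟩
  · obtain ⟨y, hyA, U, hU𝒰, hsub⟩ := exists_forall_Ioc_subset hκ hgt hgap ho hU hle
    refine (IsCoveredByLT.union hκ₀ hyA (.of_subset_mem hκ₀ hU𝒰 Subset.rfl)).mono ?_
    rintro z ⟨hxz, hz⟩
    rcases le_or_gt z y with hzy | hyz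
    · exact .inl ⟨hxz, hzy⟩
    · exact .inr (hsub z hz ⟨hyz, le_rfl⟩)

/-- If there is no gap of left type `μ`, then a strictly increasing sequence of cofinality `μ` has
two members that are joined by an interval covered by fewer than `κ` members of a given open
covering. -/
theorem exists_lt_isCoveredByLT_Icc {I : Type u} [LinearOrder I] {μ : Cardinal.{u}}
    (hκ : ℵ₀ ≤ κ) (hμ : ℵ₀ ≤ μ) (hI : Order.cof I = μ) {f : I → X} (hf : StrictMono f)
    (hgap : ∀ A B : Set X, IsGap A B → Order.cof A ≠ μ) (ho : ∀ U ∈ 𝒰, IsOpen U)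
    (hU : ⋃₀ 𝒰 = univ) : ∃ i j, i < j ∧ IsCoveredByLT 𝒰 κ (Icc (f i) (f j)) := by
  have hne : Nonempty I := cof_ne_zero_iff.1 (hI ▸ (aleph0_pos.trans_le hμ).ne')
  have htop : NoTopOrder I := cof_ne_one_iff.1 (hI ▸ (one_lt_aleph0.trans_le hμ).ne')
  have hmax : NoMaxOrder I := NoTopOrder.to_noMaxOrder I
  obtain ⟨i, U, hU𝒰, hsub⟩ := exists_forall_Icc_subset hf (hI ▸ hgap) ho hU
  obtain ⟨j, hij⟩ := exists_gt i
  exact ⟨i, j, hij, .of_subset_mem hκ hU𝒰 (hsub j)⟩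

/-- The points of `X` modulo being joined by an interval covered by fewer than `κ` members of
`𝒰`. -/
def coveredSetoid (hκ : ℵ₀ ≤ κ) (hU : ⋃₀ 𝒰 = univ) : Setoid X where
  r x y := IsCoveredByLT 𝒰 κ (Icc x y) ∧ IsCoveredByLT 𝒰 κ (Icc y x)
  iseqv :=
    { refl x := by
        obtain ⟨U, hU𝒰, hxU⟩ : x ∈ ⋃₀ 𝒰 := hU ▸ mem_univ x
        have : IsCoveredByLT 𝒰 κ (Icc x x) := .of_subset_mem hκ hU𝒰 (by simpa using hxU)
        exact ⟨this, this⟩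
      symm h := h.symm
      trans h h' := ⟨h.1.Icc_trans hκ h'.1, h'.2.Icc_trans hκ h.2⟩ }

theorem HasNoGapOfTypeIn.isIntervalCompact {𝔥 : Set Cardinal.{u}} (h : HasNoGapOfTypeIn 𝔥 X)
    {μ : Cardinal.{u}} (hμ : IsWeaklyCompactCardinal μ) (hμreg : μ.IsRegular) (hμ𝔥 : μ ∈ 𝔥)
    (hκ : κ.IsRegular) (hκ𝔥 : κ ∈ 𝔥) (hμκ : μ ≤ κ) : IsIntervalCompact κ κ X := by
  intro 𝒰 ho hU hle
  have hκ₀ := hκ.aleph0_le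
  have hgap : ∀ ν ∈ 𝔥, ∀ A B : Set X, IsGap A B → Order.cof A ≠ ν := fun ν hν A B hAB hc =>
    h A B hAB ν hν (.inl hc)
  have hgap' : ∀ ν ∈ 𝔥, ∀ A B : Set Xᵒᵈ, IsGap A B → Order.cof A ≠ ν := fun ν hν A B hAB hc =>
    h.dual A B hAB ν hν (.inl hc)
  let s : Setoid X := coveredSetoid hκ₀ hU
  have hclass : ∀ x, IsCoveredByLT 𝒰 κ {y | s x y} := fun x => by
    have h2 : IsCoveredByLT 𝒰 κ {y : X | y ≤ x ∧ IsCoveredByLT 𝒰 κ (Icc y x)} := by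
      refine IsCoveredByLT.mono (isCoveredByLT_setOf_Icc (X := Xᵒᵈ) (𝒰 := 𝒰) hκ
        (hgap' κ hκ𝔥) ho hU hle (OrderDual.toDual x)) fun y (hy : y ≤ x ∧ _) => ⟨hy.1, ?_⟩
      exact (Icc_toDual (a := x) (b := y)).symm ▸ hy.2
    refine ((isCoveredByLT_setOf_Icc hκ (hgap κ hκ𝔥) ho hU hle x).union hκ₀ h2).mono ?_
    exact fun y hy => (le_total x y).imp (fun hxy => ⟨hxy, hy.1⟩) fun hyx => ⟨hyx, hy.2⟩
  have hQ : #(Quotient s) < κ := by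
    by_contra! hQ
    obtain ⟨p, hp⟩ := le_mk_iff_exists_set.1 (hμκ.trans hQ)
    obtain ⟨e⟩ : Nonempty (μ.ord.ToType ≃ p) := Cardinal.eq.1 (by simp [hp])
    have hinj : ∀ i j, s (e i).1.out (e j).1.out → i = j := fun i j hij =>
      e.injective (Subtype.ext (Quotient.out_equiv_out.1 hij))
    obtain ⟨T, hT, hmono | hanti⟩ := hμ.exists_strictMono_or_strictAnti
      (e := fun i => (e i).1.out) fun i j hij => hinj i j (by
        simp only at hij
        rw [hij])
    · obtain ⟨i, j, hij, hc⟩ := exists_lt_isCoveredByLT_Icc hκ₀ hμreg.aleph0_le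
        (cof_eq_of_mk_eq_of_isRegular hμreg hT) hmono (hgap μ hμ𝔥) ho hU
      refine hij.ne (Subtype.ext (hinj i j ⟨hc, hc.mono ?_⟩))
      rw [Icc_eq_empty (hmono hij).not_ge]
      exact empty_subset _
    · obtain ⟨i, j, hij, hc⟩ := exists_lt_isCoveredByLT_Icc (X := Xᵒᵈ) (𝒰 := 𝒰)
        hκ₀ hμreg.aleph0_le (cof_eq_of_mk_eq_of_isRegular hμreg hT) hanti.dual_right
        (hgap' μ hμ𝔥) ho hU
      have hc' : IsCoveredByLT 𝒰 κ (Icc (e j).1.out (e i).1.out) := hc.mono fun w hw => hw.symm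
      refine hij.ne (Subtype.ext (hinj i j ⟨hc'.mono ?_, hc'⟩))
      rw [Icc_eq_empty (hanti hij).not_ge]
      exact empty_subset _
  obtain ⟨𝒱, h𝒱, hsub, hlt⟩ := IsCoveredByLT.iUnion hκ hQ fun q : Quotient s => hclass q.out
  refine ⟨𝒱, h𝒱, univ_subset_iff.1 fun x _ => hsub (mem_iUnion.2 ⟨⟦x⟧, ?_⟩), hlt⟩
  exact Quotient.mk_out x

/-- `B` misses `A`, so the rays kept by a subcovering have cofinal endpoints in `A`, and there are
at least `cof A` of them. -/
theorem IsIntervalCompact.cof_ne_of_isGap (hκ : ℵ₀ ≤ κ) (h : IsIntervalCompact κ κ X)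
    {A B : Set X} (hAB : IsGap A B) : Order.cof A ≠ κ := by
  intro hcof
  obtain ⟨s, hs, hcard⟩ := exists_cof_eq A
  have hnomax : ∀ a ∈ A, ∃ a' ∈ A, a < a' := fun a ha => by
    by_contra! hmax
    exact hAB.no_max ⟨a, ha, hmax⟩
  obtain ⟨𝒱, h𝒱, hcov, hlt⟩ := h (insert B ((fun a : A => Iio (a : X)) '' s))
    (by
      rintro U (rfl | ⟨a, -, rfl⟩)
      exacts [hAB.isOpen_right, isOpen_Iio])
    (by
      refine univ_subset_iff.1 fun x _ => ?_
      rcases hAB.union_eq.ge (mem_univ x) with hx | hx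
      · obtain ⟨a, ha, hxa⟩ := hnomax x hx
        obtain ⟨b, hb, hab⟩ := hs ⟨a, ha⟩
        exact ⟨Iio b, .inr ⟨b, hb, rfl⟩, hxa.trans_le hab⟩
      · exact ⟨B, .inl rfl, hx⟩)
    (mk_insert_le.trans ((add_le_add_left mk_image_le 1).trans (by
      rw [hcard, hcof, add_one_eq hκ])))
  have hcofinal : IsCofinal {a : A | Iio (a : X) ∈ 𝒱} := fun a => by
    obtain ⟨V, hV, haV⟩ : (a : X) ∈ ⋃₀ 𝒱 := hcov ▸ mem_univ _
    rcases h𝒱 hV with rfl | ⟨b, -, rfl⟩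
    · exact absurd (hAB.lt a a.2 a haV) (lt_irrefl _)
    · exact ⟨b, hV, le_of_lt haV⟩
  have hle : #{a : A | Iio (a : X) ∈ 𝒱} ≤ #𝒱 :=
    mk_le_of_injective (f := fun a => (⟨Iio (a.1 : X), a.2⟩ : 𝒱)) fun a b hab =>
      Subtype.ext (Subtype.ext (Iio_injective (congrArg Subtype.val hab)))
  exact (((cof_le hcofinal).trans hle).trans_lt hlt).ne hcof

theorem IsClassCompact.hasNoGapOfTypeIn {𝔥 : Set Cardinal.{u}} (h : IsClassCompact 𝔥 X)
    (h𝔥 : ∀ κ ∈ 𝔥, ℵ₀ ≤ κ) : HasNoGapOfTypeIn 𝔥 X := by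
  rintro A B hAB κ hκ (ht | ht)
  · exact (h κ hκ).cof_ne_of_isGap (h𝔥 κ hκ) hAB ht
  · have hd : IsIntervalCompact κ κ Xᵒᵈ := h κ hκ
    exact hd.cof_ne_of_isGap (h𝔥 κ hκ) hAB.dual ht

end Compactness

theorem mainTheorem1 (𝔥 : Set Cardinal.{u}) (hreg : ∀ κ ∈ 𝔥, Cardinal.IsRegular κ)
    (hinf : IsWeaklyCompactCardinal (sInf 𝔥)) : PropertyP 𝔥 := by
  intro X _ _ _
  refine ⟨fun h => h.hasNoGapOfTypeIn fun κ hκ => (hreg κ hκ).aleph0_le, fun h κ hκ => ?_⟩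
  have hmem : sInf 𝔥 ∈ 𝔥 := csInf_mem ⟨κ, hκ⟩
  exact h.isIntervalCompact hinf (hreg _ hmem) hmem (hreg κ hκ) hκ (csInf_le' hκ)
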